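/- A prefix Turing machine has a read-only one-way binary input tape, finitely many (at least one) work tapes over a finite alphabet, and a write-only one-way binary output tape; if it halts, its program is the scanned segment of the input tape. Fix a reference optimal prefix machine $U$: a prefix Turing machine with two work tapes such that for every prefix Turing machine $T$ there is a string $i$ with $U(ip)=T(p)$ for all $p$ (both undefined or both defined and equal), and such that, whenever $T(p)$ halts in $t$ steps, $U(ip)$ halts in $O(t\log t)$ steps, the constant depending only on $T$. For a binary string $x$ let $K(x)=\min\{|p| : U(p)=x\}$, let the depth of $x$ at significance $b\in\mathbb N$ be $$\mathrm{depth}_b(x)=\min\{\mathrm{time}(p) : U(p)=x,\ |p|\le K(x)+b\},$$ where $\mathrm{time}(p)$ is the number of steps of $U$ on $p$, and let $BB(n)$ be the maximal running time of $U$ on those programs of length at most $n$ on which it halts. There is an infinite sequence of binary strings $x_1,x_2,\dots$ with $|x_{m+1}|=|x_m|+1$ such that the maximal gap $$h(m)=\max_{b\ge 0}\bigl(\mathrm{depth}_b(x_m)-\mathrm{depth}_{b+1}(x_m)\bigr)$$ is attained at some $b<|x_m|-K(x_m)+O(\log|x_m|)$, for every computable $f:\mathbb N\to\mathbb N$ one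 has $h(m)>f(m)$ for all but finitely many $m$, and $$h(m)\le \mathrm{depth}_0(x_m)\le BB\bigl(|x_m|+O(\log|x_m|)\bigr),$$ where $\mathrm{depth}_0(x_m)$ is the minimal running time of a shortest program for $x_m$. The constants in $O(\log|x_m|)$ do not depend on $m$. Hence $\mathrm{depth}_0(x_m)$ also exceeds every computable function of $m$ for all but finitely many $m$, but it is at most $BB(|x_m|+O(\log|x_m|))$. -/

import Mathlib

/-- Head movements on a work tape. -/
inductive TapeMove where
  | left
  | stay
  | right

/-- A one-way infinite work tape over the alphabet `Γ`. `left` holds the squares to the left of the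
head (nearest first), `right` the squares from the head on; all squares beyond `right` are blank. -/
structure WorkTape (Γ : Type) where
  left : List Γ
  right : List Γ

namespace WorkTape

/-- The tape all of whose squares are blank, with the head on the leftmost square. -/
def empty (Γ : Type) : WorkTape Γ := ⟨[], []⟩

/-- The scanned symbol. -/
def read {Γ : Type} (blank : Γ) (T : WorkTape Γ) : Γ := T.right.headD blank

/-- Overwrite the scanned symbol. -/
def write {Γ : Type} (a : Γ) (T : WorkTape Γ) : WorkTape Γ := ⟨T.left, a :: T.right.tail⟩

/-- Move the head; on the leftmost square a move to the left leaves it where it is. -/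
def move {Γ : Type} (blank : Γ) : TapeMove → WorkTape Γ → WorkTape Γ
  | .stay, T => T
  | .right, T => ⟨T.read blank :: T.left, T.right.tail⟩
  | .left, ⟨[], r⟩ => ⟨[], r⟩
  | .left, ⟨a :: l, r⟩ => ⟨l, a :: r⟩

end WorkTape

/-- What a machine does in one step: new state, whether the input head advances by one square, the
symbol written and the head movement on every work tape, and the bit (if any) that is appended
to the output tape. -/
structure PrefixAction (Q Γ : Type) (k : ℕ) where
  state : Q
  advance : Bool
  work : Fin k → Γ × TapeMove
  out : Option Bool

/-- A prefix Turing machine: a read-only one-way binary input tape, finitely many (at least one)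
work tapes, a write-only one-way binary output tape. It halts when `δ` is `none`. -/
structure PrefixTM where
  /-- the states -/
  Q : Type
  /-- the work tape alphabet -/
  Γ : Type
  finQ : Finite Q
  finΓ : Finite Γ
  /-- the number of work tapes -/
  tapes : ℕ
  tapes_pos : 0 < tapes
  start : Q
  blank : Γ
  /-- transition function: state, scanned input bit, scanned work symbols -/
  δ : Q → Bool → (Fin tapes → Γ) → Option (PrefixAction Q Γ tapes)

namespace PrefixTM

/-- Configurations. `pos` is the square (counted from `0`) scanned by the input head. -/
structure Cfg (M : PrefixTM) where
  state : M.Q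
  pos : ℕ
  work : Fin M.tapes → WorkTape M.Γ
  out : List Bool

/-- The initial configuration: all heads on the leftmost square, work and output tapes empty. -/
def init (M : PrefixTM) : M.Cfg := ⟨M.start, 0, fun _ => WorkTape.empty M.Γ, []⟩

/-- One step on the infinite input tape `ω`; `none` if the machine has halted. -/
def step (M : PrefixTM) (ω : ℕ → Bool) (c : M.Cfg) : Option M.Cfg :=
  (M.δ c.state (ω c.pos) (fun j => (c.work j).read M.blank)).map fun a =>
    { state := a.state
      pos := if a.advance then c.pos + 1 else c.pos
      work := fun j => (((c.work j).write (a.work j).1).move M.blank (a.work j).2)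
      out := c.out ++ a.out.toList }

/-- The configuration after `t` steps; `none` if the machine has halted in fewer than `t` steps. -/
def run (M : PrefixTM) (ω : ℕ → Bool) : ℕ → Option M.Cfg
  | 0 => some M.init
  | t + 1 => (M.run ω t).bind (M.step ω)

/-- `M.Runs p y t`: the program `p` makes `M` halt after exactly `t` steps with output `y`.
That is, `M` halts on an input tape that begins with `p`, and the segment of the input tape that it
has scanned (the squares `0, …, pos`) is exactly `p`. The squares after `p`, here filled
with `0`, are never scanned, so that their contents are irrelevant. -/
def Runs (M : PrefixTM) (p y : List Bool) (t : ℕ) : Prop :=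
  ∃ c : M.Cfg, M.run (fun n => p.getD n false) t = some c ∧
    M.step (fun n => p.getD n false) c = none ∧ c.pos + 1 = p.length ∧ c.out = y

/-- `M(p) = y`. -/
def Computes (M : PrefixTM) (p y : List Bool) : Prop := ∃ t, M.Runs p y t

/-- `U` can serve as the reference optimal prefix machine: it has two work tapes, and for every
prefix Turing machine `T` there is a string `i` such that `U (i p) = T p` for all `p` (equality of
partial functions), where a computation of `T` of `t` steps takes `U` only `O(t log t)` steps. -/
def IsReferenceOptimal (U : PrefixTM) : Prop :=
  U.tapes = 2 ∧
  ∀ T : PrefixTM, ∃ i : List Bool,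
    (∀ p y, U.Computes (i ++ p) y ↔ T.Computes p y) ∧
    ∃ a : ℕ, ∀ p y t, T.Runs p y t →
      ∃ t' ≤ a * (t * Nat.log 2 t + 1), U.Runs (i ++ p) y t'

/-- Prefix-free Kolmogorov complexity `K(x)`: the length of a shortest program for `x`. -/
noncomputable def K (U : PrefixTM) (x : List Bool) : ℕ :=
  sInf {n | ∃ p, p.length = n ∧ U.Computes p x}

/-- Logical depth of `x` at significance `b`: the least running time of a program for `x` of
length at most `K(x) + b`. -/
noncomputable def depth (U : PrefixTM) (b : ℕ) (x : List Bool) : ℕ :=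
  sInf {t | ∃ p, p.length ≤ U.K x + b ∧ U.Runs p x t}

/-- The gap between the depths at significance `b` and `b + 1`; as depth is nonincreasing in the
significance, the subtraction does not truncate. -/
noncomputable def gap (U : PrefixTM) (x : List Bool) (b : ℕ) : ℕ :=
  U.depth b x - U.depth (b + 1) x

/-- The running times of the halting programs of length at most `n`. -/
def haltingTimes (U : PrefixTM) (n : ℕ) : Set ℕ :=
  {t | ∃ p y, p.length ≤ n ∧ U.Runs p y t}

/-- The Busy Beaver function: the largest running time of a halting program of length at most
`n` (and `0` if there is no such program). -/
noncomputable def BB (U : PrefixTM) (n : ℕ) : ℕ := sSup (U.haltingTimes n)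

theorem run_eq_none_of_halted {M : PrefixTM} {ω : ℕ → Bool} {t : ℕ} {c : M.Cfg}
    (h : M.run ω t = some c) (h' : M.step ω c = none) (s : ℕ) : M.run ω (t + 1 + s) = none := by
  induction s with
  | zero => simp [run, h, h']
  | succ s ih => rw [← Nat.add_assoc]; simp [run, ih]

theorem Runs.time_unique {M : PrefixTM} {p y z : List Bool} {s t : ℕ}
    (h : M.Runs p y s) (h' : M.Runs p z t) : s = t := by
  obtain ⟨c, hc, hs, -, -⟩ := h
  obtain ⟨d, hd, ht, -, -⟩ := h'
  rcases lt_trichotomy s t with hlt | rfl | hlt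
  · obtain ⟨r, rfl⟩ := Nat.exists_eq_add_of_lt hlt
    have := run_eq_none_of_halted hc hs r
    rw [show s + 1 + r = s + r + 1 by omega, hd] at this
    simp at this
  · rfl
  · obtain ⟨r, rfl⟩ := Nat.exists_eq_add_of_lt hlt
    have := run_eq_none_of_halted hd ht r
    rw [show t + 1 + r = t + r + 1 by omega, hc] at this
    simp at this

/-- The maximum in the definition of `BB` is over a finite set. -/
theorem haltingTimes_finite (U : PrefixTM) (n : ℕ) : (U.haltingTimes n).Finite := by
  have hfin : {p : List Bool | p.length ≤ n}.Finite := List.finite_length_le Bool n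
  have hsub : U.haltingTimes n ⊆
      ⋃ p ∈ {p : List Bool | p.length ≤ n}, {t | ∃ y, U.Runs p y t} := by
    rintro t ⟨p, y, hp, h⟩
    simp only [Set.mem_iUnion]
    exact ⟨p, hp, y, h⟩
  refine (hfin.biUnion fun p _ => Set.Subsingleton.finite ?_).subset hsub
  rintro s ⟨y, hy⟩ t ⟨z, hz⟩
  exact hy.time_unique hz

end PrefixTM

/-! Take for `x m` a string of maximal depth at significance `0` among those of its length `n`.
Printing a string behind a self-delimiting code of its length gives every string of length `n ≥ 2` a
program shorter than `B = n + c log n` (`exists_length_lt`). Running all these programs until every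
string of length `n` has appeared gives a computable time bound `D n`
(`exists_computable_forall_mem_outputs`). So a string of length `n` has depth at most `D n` once the
significance is at least `B - K`.

Depth at significance `0` is large for some string: given a computable `g`, the first string of
length `n` that no program shorter than `n` outputs within `g n` steps is computable from `n`. Its
complexity is at most `2 log n + O(1) < n`, so its shortest programs all need more than `g n` steps
(`eventually_exists_lt_depth`). The deepest string is at least as deep.

From significance `0` to `B` the depth falls from more than `g n` to at most `D n` in `B` steps
(`depth_zero_le_depth_add`). With `g = D + B f` some step exceeds `f n` (`eventually_lt_gap`). With
`f = D` the largest gap exceeds `D n`, so it cannot occur where the depth is already at most `D n`;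
this locates it below `B - K`. The Busy Beaver bound holds because a shortest program is shorter
than `B`.

Two facts about the machine model support this: prefix machines evaluate computable functions on
self-delimiting input (`exists_prefixTM_of_computable`, `exists_prefixTM_print`), and bounded runs
of a machine are primitive recursive (`primrec_outputs`). -/

theorem primrec_nat_pow (b : ℕ) : Primrec fun n : ℕ => b ^ n :=
  (Primrec.nat_rec₁ (f := fun _ r => b * r) 1
    (Primrec.nat_mul.comp (Primrec.const b) Primrec.snd)).of_eq fun n => by
      induction n with
      | zero => rfl
      | succ n ih => simp only at ih ⊢; rw [ih, pow_succ, mul_comm]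

/-! ### Strings as numbers, and self-delimiting headers. -/

namespace PrefixTM

/-- The number whose binary digits are those of the string, least significant first, followed by a
leading `1`. -/
def strNat : List Bool → ℕ
  | [] => 1
  | b :: y => Nat.bit b (strNat y)

theorem strNat_ne_zero (y : List Bool) : strNat y ≠ 0 := by
  induction y with
  | nil => simp [strNat]
  | cons b y ih => simp [strNat, ih]

theorem exists_strNat_eq {n : ℕ} (hn : n ≠ 0) : ∃ y, strNat y = n ∧ y.length = Nat.log 2 n := by
  induction n using Nat.strong_induction_on with
  | _ n ih =>
    rcases Nat.lt_or_ge n 2 with h | h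
    · exact ⟨[], by simp only [strNat]; omega, by simp [Nat.log_of_lt h]⟩
    · obtain ⟨y, hy, hl⟩ := ih (n / 2) (by omega) (by omega)
      refine ⟨n.bodd :: y, ?_, ?_⟩
      · rw [strNat, hy, ← Nat.div2_val, Nat.bit_bodd_div2]
      · rw [List.length_cons, hl, Nat.log_of_one_lt_of_le one_lt_two h]

theorem strNat_replicate_false (n : ℕ) : strNat (List.replicate n false) = 2 ^ n := by
  induction n with
  | zero => rfl
  | succ n ih => rw [List.replicate_succ, strNat, ih, Nat.bit_val, pow_succ]; simp [mul_comm]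

open Turing Turing.PartrecToTM2

/-- The stack symbol of a binary digit. -/
def bitSym (b : Bool) : Γ' := if b then Γ'.bit1 else Γ'.bit0

/-- This is why `strNat` has a leading one: strings, including those ending in zeros, are read off
digit by digit from the stack encoding of a number. -/
theorem trNat_strNat (y : List Bool) : trNat (strNat y) = y.map bitSym ++ [Γ'.bit1] := by
  induction y with
  | nil => simp [strNat, trNat, trNum, trPosNum]
  | cons b y ih =>
    have h0 : ((strNat y : ℕ) : Num) ≠ 0 := by
      intro h
      exact strNat_ne_zero y (by exact_mod_cast h)
    rw [strNat, trNat, ← Num.ofNat'_eq, Num.ofNat'_bit, Num.ofNat'_eq]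
    rw [trNat] at ih
    cases hz : ((strNat y : ℕ) : Num) with
    | zero => exact absurd hz h0
    | pos p =>
      rw [hz] at ih
      cases b <;> simpa [trNum, trPosNum, Num.bit0, Num.bit1, bitSym] using ih

/-- The self-delimiting header that makes the machines below start with the number `strNat y`. -/
def header : List Bool → List Bool
  | [] => []
  | b :: y => header y ++ [true, b]

theorem length_header (y : List Bool) : (header y).length = 2 * y.length := by
  induction y with
  | nil => rfl
  | cons b y ih => simp [header, ih]; ring

/-! ### A prefix machine that runs a stack machine for partial recursive functions. -/

/-- The statements of the stack machine that evaluates partial recursive functions. -/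
abbrev StackStmt := TM2.Stmt (fun _ : K' => Γ') Λ' (Option Γ')

/-- The configurations of the stack machine. -/
abbrev StackCfg := TM2.Cfg (fun _ : K' => Γ') Λ' (Option Γ')

/-- The program of the stack machine. -/
def stackProg : Λ' → StackStmt := tr

/-- The states of a machine that runs a stack machine, apart from those in the middle of a push. -/
inductive Phase (P : Type)
  | start
  | lead
  | flag
  | digit
  | exec (q : P) (v : Option Γ')
  | output (pending : Option Bool)

instance {P : Type} [Finite P] : Finite (Phase P) := by
  refine Finite.of_injective (β := Fin 4 ⊕ (P × Option Γ') ⊕ Option Bool)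
    (fun s => match s with
      | .start => .inl 0
      | .lead => .inl 1
      | .flag => .inl 2
      | .digit => .inl 3
      | .exec q v => .inr (.inl (q, v))
      | .output p => .inr (.inr p)) ?_
  rintro (_ | _ | _ | _ | ⟨q, v⟩ | p) (_ | _ | _ | _ | ⟨q', v'⟩ | p') h <;> simp_all

/-- The work tape that holds a given stack. -/
def tapeOf : K' → Fin 4
  | .main => 0
  | .rev => 1
  | .aux => 2
  | .stack => 3

theorem tapeOf_injective : Function.Injective tapeOf := by
  rintro (_ | _) (_ | _) h <;> first | rfl | exact absurd h (by decide)

instance : Finite K' := Finite.of_injective tapeOf tapeOf_injective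

/-- A subset of the statements that is closed under taking successors in the computation of `c`. -/
noncomputable def codeStmts (c : ToPartrec.Code) : Finset (Option StackStmt) :=
  TM2.stmts stackProg (codeSupp c Cont'.halt)

/-- The statements of `c`, as a finite type. -/
def CodeStmt (c : ToPartrec.Code) : Type :=
  {q : StackStmt // q = TM2.Stmt.halt ∨ some q ∈ codeStmts c}

open scoped Classical in
/-- A statement as a statement of `c`. -/
noncomputable def toCodeStmt (c : ToPartrec.Code) (q : StackStmt) : CodeStmt c :=
  if h : some q ∈ codeStmts c then ⟨q, .inr h⟩ else ⟨TM2.Stmt.halt, .inl rfl⟩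

/-- The default `halt` only makes `toCodeStmt` total; the simulation stays inside `codeStmts c`,
where nothing is lost. -/
theorem toCodeStmt_val {c : ToPartrec.Code} {q : StackStmt} (h : some q ∈ codeStmts c) :
    (toCodeStmt c q).1 = q := by simp [toCodeStmt, h]

instance (c : ToPartrec.Code) : Finite (CodeStmt c) := by
  have : {q : StackStmt | q = TM2.Stmt.halt ∨ some q ∈ codeStmts c}.Finite := by
    refine Set.Finite.union (Set.finite_singleton _) ?_
    exact Set.Finite.preimage (Option.some_injective _).injOn (codeStmts c).finite_toSet
  exact this

/-- The states of the machine that runs `c`. -/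
abbrev CodeState (c : ToPartrec.Code) : Type :=
  Phase (CodeStmt c) ⊕ (K' × Γ' × Phase (CodeStmt c))

/-- An action that changes the work tape `j` only. -/
def actOn {Q Γ : Type} {k : ℕ} (r : Fin k → Γ) (j : Fin k) (a : Γ) (m : TapeMove) (s : Q)
    (adv : Bool) (o : Option Bool) : PrefixAction Q Γ k :=
  ⟨s, adv, Function.update (fun i => (r i, TapeMove.stay)) j (a, m), o⟩

/-- An action that changes no work tape. -/
def actIdle {Q Γ : Type} {k : ℕ} (r : Fin k → Γ) (s : Q) (adv : Bool) : PrefixAction Q Γ k :=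
  ⟨s, adv, fun i => (r i, TapeMove.stay), none⟩

/-- The first half of pushing `a`: move to the next square. -/
def pushAct {P : Type} (r : Fin 4 → Option Γ') (k : K') (a : Γ') (s : Phase P) (adv : Bool) :
    PrefixAction (Phase P ⊕ (K' × Γ' × Phase P)) (Option Γ') 4 :=
  actOn r (tapeOf k) (r (tapeOf k)) .right (.inr (k, a, s)) adv none

/-- Pop a symbol. -/
def popAct {P : Type} (r : Fin 4 → Option Γ') (k : K') (s : Phase P) (adv : Bool)
    (o : Option Bool) : PrefixAction (Phase P ⊕ (K' × Γ' × Phase P)) (Option Γ') 4 :=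
  actOn r (tapeOf k) (r (tapeOf k)) .left (.inl s) adv o

/-- The action on a statement. -/
noncomputable def stmtAct (c : ToPartrec.Code) (r : Fin 4 → Option Γ') (v : Option Γ') :
    StackStmt → PrefixAction (CodeState c) (Option Γ') 4
  | .push k f q => pushAct r k (f v) (.exec (toCodeStmt c q) v) false
  | .peek k f q => actIdle r (.inl (.exec (toCodeStmt c q) (f v (r (tapeOf k))))) false
  | .pop k f q => popAct r k (.exec (toCodeStmt c q) (f v (r (tapeOf k)))) false none
  | .load f q => actIdle r (.inl (.exec (toCodeStmt c q) (f v))) false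
  | .branch f q₁ q₂ => actIdle r (.inl (.exec (toCodeStmt c (cond (f v) q₁ q₂)) v)) false
  | .goto l => actIdle r (.inl (.exec (toCodeStmt c (stackProg (l v))) v)) false
  | .halt => actIdle r (.inl (.output none)) false

/-- The action in the output phase that reads the digit `d`. -/
def outputAct {P : Type} (copy : Bool) (b : Bool) (r : Fin 4 → Option Γ') (pending : Option Bool)
    (d : Bool) : PrefixAction (Phase P ⊕ (K' × Γ' × Phase P)) (Option Γ') 4 :=
  popAct r .main (.output (some d)) (copy && pending.isSome)
    (pending.map fun a => if copy then b else a)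

/-- The transition function of the machine that runs `c`. -/
noncomputable def codeδ (c : ToPartrec.Code) (copy : Bool) :
    CodeState c → Bool → (Fin 4 → Option Γ') → Option (PrefixAction (CodeState c) (Option Γ') 4)
  | .inr (k, a, s), _, r => some (actOn r (tapeOf k) (some a) .stay (.inl s) false none)
  | .inl .start, _, r => some (pushAct r .main .cons .lead false)
  | .inl .lead, _, r => some (pushAct r .main .bit1 .flag false)
  | .inl .flag, true, r => some (actIdle r (.inl .digit) true)
  | .inl .flag, false, r =>
    some (actIdle r (.inl (.exec (toCodeStmt c (stackProg (trNormal c Cont'.halt))) none)) true)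
  | .inl .digit, b, r => some (pushAct r .main (bitSym b) .flag true)
  | .inl (.exec q v), _, r => some (stmtAct c r v q.1)
  | .inl (.output o), b, r => match r (tapeOf .main) with
    | some .bit0 => some (outputAct copy b r o false)
    | some .bit1 => some (outputAct copy b r o true)
    | _ => none

/-- The machine that reads a header, runs `c` on the number in it, and then writes the digits of
the result, up to the leading one, to the output tape (if `copy` is `false`), or copies as many
input bits to the output tape (if `copy` is `true`). -/
noncomputable def codeMachine (c : ToPartrec.Code) (copy : Bool) : PrefixTM where
  Q := CodeState c
  Γ := Option Γ'
  finQ := inferInstance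
  finΓ := inferInstance
  tapes := 4
  tapes_pos := by decide
  start := .inl .start
  blank := none
  δ := codeδ c copy

@[simp] theorem codeMachine_blank (c : ToPartrec.Code) (copy : Bool) :
    (codeMachine c copy).blank = (none : Option Γ') := rfl

/-! ### Stacks on work tapes. -/

/-- The tape holds the stack `l`, with the bottom at the left end and the head on the top. -/
def Holds (T : WorkTape (Option Γ')) (l : List Γ') : Prop :=
  T.read none :: T.left = l.map some ++ [none]

theorem Holds.read {T : WorkTape (Option Γ')} {l : List Γ'} (h : Holds T l) :
    T.read none = l.head? := by
  cases l <;> simp_all [Holds]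

theorem holds_empty : Holds (WorkTape.empty _) [] := rfl

theorem Holds.idle {T : WorkTape (Option Γ')} {l : List Γ'} (h : Holds T l) :
    Holds ((T.write (T.read none)).move none .stay) l := h

/-- The leftmost square stays blank and marks the bottom. A left move there has no effect, in
agreement with `[].tail = []`. Symbols left behind to the right of the head do not matter, since a
push overwrites them. -/
theorem Holds.pop {T : WorkTape (Option Γ')} {l : List Γ'} (h : Holds T l) :
    Holds ((T.write (T.read none)).move none .left) l.tail := by
  obtain ⟨L, R⟩ := T
  cases l with
  | nil =>
    simp only [Holds, List.map_nil, List.nil_append, List.cons.injEq] at h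
    obtain ⟨h, rfl⟩ := h
    rw [h]
    rfl
  | cons a l =>
    simp only [Holds, List.map_cons, List.cons_append, List.cons.injEq] at h
    obtain ⟨-, h⟩ := h
    cases L with
    | nil => simp at h
    | cons b L => exact h

/-- A step writes before it moves, so a push takes two steps. -/
theorem Holds.push {T : WorkTape (Option Γ')} {l : List Γ'} (h : Holds T l) (a : Γ') :
    Holds ((((T.write (T.read none)).move none .right).write (some a)).move none .stay)
      (a :: l) := by
  simpa [Holds, WorkTape.write, WorkTape.move, WorkTape.read] using h

/-! ### Correctness of the simulation. -/

variable {c : ToPartrec.Code} {copy : Bool} {ω : ℕ → Bool}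

/-- The configuration of the machine is in state `s`, at position `pos`, with stacks `S` and output
`o`. -/
structure IsCfg (x : (codeMachine c copy).Cfg) (s : Phase (CodeStmt c)) (pos : ℕ)
    (S : K' → List Γ') (o : List Bool) : Prop where
  state : x.state = .inl s
  pos : x.pos = pos
  work : ∀ k, Holds (x.work (tapeOf k)) (S k)
  out : x.out = o

/-- A computation leads from one description of a configuration to another. -/
def Leads (c : ToPartrec.Code) (copy : Bool) (ω : ℕ → Bool)
    (s : Phase (CodeStmt c)) (pos : ℕ) (S : K' → List Γ') (o : List Bool)
    (s' : Phase (CodeStmt c)) (pos' : ℕ) (S' : K' → List Γ') (o' : List Bool) : Prop :=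
  ∀ x : (codeMachine c copy).Cfg, IsCfg x s pos S o →
    ∃ y, Relation.ReflTransGen (fun a b => (codeMachine c copy).step ω a = some b) x y ∧
      IsCfg y s' pos' S' o'

theorem Leads.refl {s : Phase (CodeStmt c)} {pos S o} : Leads c copy ω s pos S o s pos S o :=
  fun x hx => ⟨x, .refl, hx⟩

theorem Leads.trans {s : Phase (CodeStmt c)} {pos S o s' pos' S' o' s'' pos'' S'' o''}
    (h : Leads c copy ω s pos S o s' pos' S' o')
    (h' : Leads c copy ω s' pos' S' o' s'' pos'' S'' o'') :
    Leads c copy ω s pos S o s'' pos'' S'' o'' := by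
  intro x hx
  obtain ⟨y, hy, hy'⟩ := h x hx
  obtain ⟨z, hz, hz'⟩ := h' y hy'
  exact ⟨z, hy.trans hz, hz'⟩

/-- The result of an action. -/
def Cfg.act {M : PrefixTM} (x : M.Cfg) (a : PrefixAction M.Q M.Γ M.tapes) : M.Cfg where
  state := a.state
  pos := if a.advance then x.pos + 1 else x.pos
  work := fun j => (((x.work j).write (a.work j).1).move M.blank (a.work j).2)
  out := x.out ++ a.out.toList

theorem step_eq_map_act (M : PrefixTM) (ω : ℕ → Bool) (x : M.Cfg) :
    M.step ω x =
      (M.δ x.state (ω x.pos) fun j => (x.work j).read M.blank).map x.act := rfl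

theorem Cfg.act_actOn_self {M : PrefixTM} (x : M.Cfg) (r : Fin M.tapes → M.Γ) (j : Fin M.tapes)
    (a : M.Γ) (m : TapeMove) (s : M.Q) (adv : Bool) (o : Option Bool) :
    (x.act (actOn r j a m s adv o)).work j = ((x.work j).write a).move M.blank m := by
  simp [act, actOn]

theorem Cfg.act_actOn_of_ne {M : PrefixTM} (x : M.Cfg) (r : Fin M.tapes → M.Γ)
    {i j : Fin M.tapes} (h : i ≠ j)
    (a : M.Γ) (m : TapeMove) (s : M.Q) (adv : Bool) (o : Option Bool) :
    (x.act (actOn r j a m s adv o)).work i = ((x.work i).write (r i)).move M.blank .stay := by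
  simp [act, actOn, h]

theorem step_codeMachine {x : (codeMachine c copy).Cfg} {s : CodeState c} (hs : x.state = s)
    {a : PrefixAction (CodeState c) (Option Γ') 4}
    (h : codeδ c copy s (ω x.pos) (fun j => (x.work j).read none) = some a) :
    (codeMachine c copy).step ω x = some (x.act a) := by
  subst hs
  rw [step_eq_map_act]
  exact congrArg (Option.map x.act) h

theorem leads_idle {s s' : Phase (CodeStmt c)} {pos : ℕ} {S : K' → List Γ'} {o : List Bool}
    (adv : Bool)
    (h : ∀ r, (∀ k, r (tapeOf k) = (S k).head?) →
      codeδ c copy (.inl s) (ω pos) r = some (actIdle r (.inl s') adv)) :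
    Leads c copy ω s pos S o s' (if adv then pos + 1 else pos) S o := by
  intro x hx
  have h := h (fun j => (x.work j).read none) fun k => (hx.work k).read
  rw [← hx.pos] at h ⊢
  refine ⟨_, .single (step_codeMachine hx.state h), rfl, rfl, fun k => (hx.work k).idle, ?_⟩
  simp [Cfg.act, actIdle, hx.out]

theorem leads_pop {s s' : Phase (CodeStmt c)} {pos : ℕ} {S : K' → List Γ'} {o : List Bool}
    (k : K') (adv : Bool) (w : Option Bool)
    (h : ∀ r, (∀ k, r (tapeOf k) = (S k).head?) →
      codeδ c copy (.inl s) (ω pos) r = some (popAct r k s' adv w)) :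
    Leads c copy ω s pos S o s' (if adv then pos + 1 else pos)
      (Function.update S k (S k).tail) (o ++ w.toList) := by
  intro x hx
  have h := h (fun j => (x.work j).read none) fun k => (hx.work k).read
  rw [← hx.pos] at h ⊢
  refine ⟨_, .single (step_codeMachine hx.state h), rfl, rfl, fun k' => ?_, ?_⟩
  · by_cases hk : k' = k
    · subst hk
      rw [Function.update_self]
      exact (congrArg (Holds · _) (Cfg.act_actOn_self x ..)).mpr (hx.work k').pop
    · have : tapeOf k' ≠ tapeOf k := fun h => hk (tapeOf_injective h)
      rw [Function.update_of_ne hk]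
      exact (congrArg (Holds · _) (Cfg.act_actOn_of_ne x _ this ..)).mpr (hx.work k').idle
  · simp [Cfg.act, popAct, actOn, hx.out]

theorem leads_push {s s' : Phase (CodeStmt c)} {pos : ℕ} {S : K' → List Γ'} {o : List Bool}
    (k : K') (adv : Bool) (a : Γ')
    (h : ∀ r, (∀ k, r (tapeOf k) = (S k).head?) →
      codeδ c copy (.inl s) (ω pos) r = some (pushAct r k a s' adv)) :
    Leads c copy ω s pos S o s' (if adv then pos + 1 else pos)
      (Function.update S k (a :: S k)) o := by
  intro x hx
  have h := h (fun j => (x.work j).read none) fun k => (hx.work k).read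
  rw [← hx.pos] at h ⊢
  refine ⟨_, .head (step_codeMachine hx.state h) (.single (step_codeMachine rfl rfl)),
    rfl, rfl, fun k' => ?_, ?_⟩
  · by_cases hk : k' = k
    · subst hk
      rw [Function.update_self]
      refine (congrArg (Holds · _) (Cfg.act_actOn_self (M := codeMachine c copy) _ ..)).mpr ?_
      refine (congrArg (fun T => Holds ((WorkTape.write _ T).move none .stay) _)
        (Cfg.act_actOn_self (M := codeMachine c copy) x ..)).mpr ?_
      exact (hx.work k').push a
    · have : tapeOf k' ≠ tapeOf k := fun h => hk (tapeOf_injective h)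
      rw [Function.update_of_ne hk]
      refine (congrArg (Holds · _) (Cfg.act_actOn_of_ne (M := codeMachine c copy) _ _ this ..)).mpr ?_
      refine (congrArg (fun T => Holds ((WorkTape.write (T.read none) T).move none .stay) _)
        (Cfg.act_actOn_of_ne (M := codeMachine c copy) x _ this ..)).mpr ?_
      exact (hx.work k').idle.idle
  · simp [Cfg.act, pushAct, actOn, hx.out]

/-- The phase that corresponds to a configuration of the stack machine. -/
noncomputable def phaseOf (c : ToPartrec.Code) (x : StackCfg) : Phase (CodeStmt c) :=
  match x.l with
  | some l => .exec (toCodeStmt c (stackProg l)) x.var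
  | none => .output none

/-- One step of the stack machine executes a whole statement, the prefix machine one constructor at
a time; hence the induction on `q`. Substatements remain in `codeStmts c` by `TM2.stmts_trans`. -/
theorem leads_stmt {q : StackStmt} (hq : some q ∈ codeStmts c) (v : Option Γ') (S : K' → List Γ')
    (pos : ℕ) (o : List Bool) :
    Leads c copy ω (.exec (toCodeStmt c q) v) pos S o
      (phaseOf c (TM2.stepAux q v S)) pos (TM2.stepAux q v S).stk o := by
  induction q generalizing v S with
  | push k f q ih =>
    refine (leads_push k false (f v) fun r hr => ?_).trans
      (ih (TM2.stmts_trans (by simp [TM2.stmts₁, TM2.stmts₁_self]) hq) _ _)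
    simp only [codeδ, toCodeStmt_val hq, stmtAct]
  | peek k f q ih =>
    refine (leads_idle false fun r hr => ?_).trans
      (ih (TM2.stmts_trans (by simp [TM2.stmts₁, TM2.stmts₁_self]) hq) _ _)
    simp only [codeδ, toCodeStmt_val hq, stmtAct, hr]
  | pop k f q ih =>
    refine .trans (o' := o) ?_
      (ih (TM2.stmts_trans (by simp [TM2.stmts₁, TM2.stmts₁_self]) hq) _ _)
    have := leads_pop (c := c) (copy := copy) (ω := ω) (pos := pos) (o := o) (S := S)
      (s := .exec (toCodeStmt c (.pop k f q)) v)
      (s' := .exec (toCodeStmt c q) (f v (S k).head?)) k false none fun r hr => by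
        simp only [codeδ, toCodeStmt_val hq, stmtAct, hr]
    simpa using this
  | load f q ih =>
    refine (leads_idle false fun r hr => ?_).trans
      (ih (TM2.stmts_trans (by simp [TM2.stmts₁, TM2.stmts₁_self]) hq) _ _)
    simp only [codeδ, toCodeStmt_val hq, stmtAct]
  | branch f q₁ q₂ ih₁ ih₂ =>
    rw [TM2.stepAux]
    cases hf : f v with
    | true =>
      refine (leads_idle false fun r hr => ?_).trans
        (ih₁ (TM2.stmts_trans (by simp [TM2.stmts₁, TM2.stmts₁_self]) hq) _ _)
      simp only [codeδ, toCodeStmt_val hq, stmtAct, hf]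
      rfl
    | false =>
      refine (leads_idle false fun r hr => ?_).trans
        (ih₂ (TM2.stmts_trans (by simp [TM2.stmts₁, TM2.stmts₁_self]) hq) _ _)
      simp only [codeδ, toCodeStmt_val hq, stmtAct, hf]
      rfl
  | goto l =>
    refine leads_idle false fun r hr => ?_
    simp only [codeδ, toCodeStmt_val hq, stmtAct, phaseOf, TM2.stepAux]
  | halt =>
    refine leads_idle false fun r hr => ?_
    simp only [codeδ, toCodeStmt_val hq, stmtAct, phaseOf, TM2.stepAux]

theorem tr_mem_codeStmts {l : Λ'} (hl : l ∈ codeSupp c Cont'.halt) :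
    some (stackProg l) ∈ codeStmts c := by
  simp only [codeStmts, TM2.stmts, Finset.some_mem_insertNone, Finset.mem_biUnion]
  exact ⟨l, hl, TM2.stmts₁_self⟩

/-- The labels reached stay in the finite set `codeSupp` by `tr_supports`, so finitely many states
suffice for the whole computation. -/
theorem leads_of_reaches {x y : StackCfg} (h : StateTransition.Reaches (TM2.step stackProg) x y)
    (hx : x.l ∈ Finset.insertNone (codeSupp c Cont'.halt)) (pos : ℕ) (o : List Bool) :
    Leads c copy ω (phaseOf c x) pos x.stk o (phaseOf c y) pos y.stk o := by
  induction h using Relation.ReflTransGen.head_induction_on with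
  | refl => exact .refl
  | @head x z hxz _ ih =>
    have hz := @TM2.step_supports _ _ _ _ ⟨trNormal c Cont'.halt⟩ _ stackProg _
      (tr_supports c _) _ _ hxz hx
    refine Leads.trans ?_ (ih hz)
    obtain ⟨_ | l, v, S⟩ := x
    · simp at hxz
    · obtain rfl : TM2.stepAux (stackProg l) v S = z := by simpa using hxz
      exact leads_stmt (tr_mem_codeStmts (by simpa using hx)) v S pos o

theorem leads_code {n m : ℕ} (h : c.eval [n] = pure [m]) (pos : ℕ) (o : List Bool) :
    Leads c copy ω (.exec (toCodeStmt c (stackProg (trNormal c Cont'.halt))) none) pos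
      (K'.elim (trList [n]) [] [] []) o (.output none) pos (K'.elim (trList [m]) [] [] []) o := by
  have h' : PartrecToTM2.halt [m] ∈ PartrecToTM2.halt <$> c.eval [n] := by
    rw [h]
    exact Part.mem_map _ (Part.mem_some _)
  rw [← tr_eval] at h'
  have hm : (PartrecToTM2.halt [m] : StackCfg) ∈
    StateTransition.eval (TM2.step stackProg) (PartrecToTM2.init c [n] : StackCfg) := h'
  refine leads_of_reaches (StateTransition.mem_eval.1 hm).1 ?_ pos o
  exact Finset.some_mem_insertNone.2 (codeSupp_self _ _ (trStmts₁_self _))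

/-- Each digit is announced by the flag `true`. The header lists the most significant digit first,
so the least significant one is pushed last and ends on top, as the stack encoding requires. -/
theorem leads_header (y : List Bool) (h : ∀ i < (header y).length, ω i = (header y).getD i false) :
    Leads c copy ω .flag 0 (K'.elim [.bit1, .cons] [] [] []) []
      .flag (header y).length (K'.elim (y.map bitSym ++ [.bit1, .cons]) [] [] []) [] := by
  induction y with
  | nil => exact .refl
  | cons b y ih =>
    have h₁ : ω (header y).length = true := by
      rw [h _ (by simp [header])]
      simp [header]
    have h₂ : ω ((header y).length + 1) = b := by
      rw [h _ (by simp [header])]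
      simp [header]
    refine (ih fun i hi => ?_).trans ((leads_idle (s' := .digit) true fun r hr => ?_).trans ?_)
    · rw [h i (by simp [header]; omega), header, List.getD_append _ _ _ _ hi]
    · rw [h₁]
      rfl
    · have := leads_push (c := c) (copy := copy) (ω := ω) (s := .digit) (s' := .flag)
        (pos := (header y).length + 1) (o := [])
        (S := K'.elim (y.map bitSym ++ [.bit1, .cons]) [] [] []) .main true (bitSym b)
        fun r hr => by rw [h₂]; rfl
      rw [K'.elim_update_main] at this
      simpa [header] using this

theorem leads_output_pop (b b' : Bool) (w : List Bool) (p : Option Bool) (pos : ℕ) (o : List Bool)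
    (hb : ω pos = b) :
    Leads c copy ω (.output p) pos (K'.elim ((b' :: w).map bitSym ++ [.cons]) [] [] []) o
      (.output (some b')) (if copy && p.isSome then pos + 1 else pos)
      (K'.elim (w.map bitSym ++ [.cons]) [] [] [])
      (o ++ (p.map fun a => if copy then b else a).toList) := by
  have := leads_pop (c := c) (copy := copy) (ω := ω) (s := .output p) (s' := .output (some b'))
    (pos := pos) (o := o) (S := K'.elim ((b' :: w).map bitSym ++ [.cons]) [] [] []) .main
    (copy && p.isSome) (p.map fun a => if copy then b else a) fun r hr => by
      have := hr .main
      cases b' <;> simp [bitSym] at this <;> simp [codeδ, this, outputAct, hb]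
  rwa [K'.elim_update_main] at this

/-- Output lags one digit behind the pops. The leading one, popped last, is still pending when the
machine meets `cons` and is never written: hence `dropLast`. -/
theorem leads_output_digits (w : List Bool) (b : Bool) (pos : ℕ) (o : List Bool) :
    ∃ p, Leads c false ω (.output (some b)) pos (K'.elim (w.map bitSym ++ [.cons]) [] [] []) o
      (.output p) pos (K'.elim [.cons] [] [] []) (o ++ (b :: w).dropLast) := by
  induction w generalizing b o with
  | nil => exact ⟨some b, by simpa using Leads.refl⟩
  | cons a w ih =>
    obtain ⟨p, hp⟩ := ih a (o ++ [b])
    refine ⟨p, (leads_output_pop _ a w (some b) pos o rfl).trans ?_⟩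
    simpa using hp

/-- The digits act only as a counter: each pop with a digit pending copies one input bit. -/
theorem leads_output_copy (w z : List Bool) (b : Bool) (pos : ℕ) (o : List Bool)
    (hz : z.length = w.length) (h : ∀ i < z.length, ω (pos + i) = z.getD i false) :
    ∃ p, Leads c true ω (.output (some b)) pos (K'.elim (w.map bitSym ++ [.cons]) [] [] []) o
      (.output p) (pos + z.length) (K'.elim [.cons] [] [] []) (o ++ z) := by
  induction w generalizing b o z pos with
  | nil =>
    obtain rfl := List.length_eq_zero_iff.1 hz
    exact ⟨some b, by simpa using Leads.refl⟩
  | cons a w ih =>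
    cases z with
    | nil => simp at hz
    | cons d z =>
      obtain ⟨p, hp⟩ := ih z a (pos + 1) (o ++ [d]) (by simpa using hz) fun i hi => by
        have := h (i + 1) (by simpa using hi)
        rw [List.getD_cons_succ] at this
        rw [← this]
        congr 1
        ring
      refine ⟨p, (leads_output_pop d a w (some b) pos o (by simpa using h 0 (by simp))).trans ?_⟩
      simpa [add_assoc, add_comm 1] using hp

theorem exists_run_of_reaches {M : PrefixTM} {ω : ℕ → Bool} {x : M.Cfg}
    (h : Relation.ReflTransGen (fun a b => M.step ω a = some b) M.init x) :
    ∃ t, M.run ω t = some x := by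
  induction h with
  | refl => exact ⟨0, rfl⟩
  | tail _ hab ih =>
    obtain ⟨t, ht⟩ := ih
    exact ⟨t + 1, by simp [run, ht, hab]⟩

/-- The machine halts on `cons` with its input head on square `pos`. That square counts as scanned,
which is why the programs below end in an extra `false`. -/
theorem computes_of_leads {p w : List Bool} {q : Option Bool} {S : K' → List Γ'} {pos : ℕ}
    (h : Leads c copy (fun n => p.getD n false) .flag 0 (K'.elim [.bit1, .cons] [] [] []) []
      (.output q) pos S w) (hS : S .main = [.cons]) (hp : pos + 1 = p.length) :
    (codeMachine c copy).Computes p w := by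
  have h₀ : Leads c copy (fun n => p.getD n false) .start 0 (K'.elim [] [] [] []) [] .flag 0
      (K'.elim [.bit1, .cons] [] [] []) [] := by
    have h₁ := leads_push (c := c) (copy := copy) (ω := fun n => p.getD n false) (s := .start)
      (s' := .lead) (pos := 0) (o := []) (S := K'.elim [] [] [] []) .main false .cons
      fun r hr => rfl
    have h₂ := leads_push (c := c) (copy := copy) (ω := fun n => p.getD n false) (s := .lead)
      (s' := .flag) (pos := 0) (o := []) (S := K'.elim [.cons] [] [] []) .main false .bit1
      fun r hr => rfl
    rw [K'.elim_update_main] at h₁ h₂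
    exact h₁.trans h₂
  obtain ⟨x, hx, hx'⟩ := h₀.trans h (codeMachine c copy).init
    ⟨rfl, rfl, fun k => by cases k <;> exact holds_empty, rfl⟩
  obtain ⟨t, ht⟩ := exists_run_of_reaches hx
  refine ⟨t, x, ht, ?_, by rw [hx'.pos, hp], hx'.out⟩
  have hr : (x.work (tapeOf .main)).read none = some Γ'.cons := by
    rw [(hx'.work .main).read, hS]
    rfl
  rw [step_eq_map_act, Option.map_eq_none_iff, hx'.state]
  change codeδ c copy (.inl (.output q)) _ (fun j => (x.work j).read none) = none
  simp only [codeδ, hr]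

theorem exists_code_of_computable {F : ℕ → ℕ} (hF : Computable F) :
    ∃ c : ToPartrec.Code, ∀ n, c.eval [n] = pure [F n] := by
  have h : @Nat.Partrec' 1 fun v => (F v.head : Part ℕ) := Nat.Partrec'.part_iff₁.2 hF.partrec
  obtain ⟨c, hc⟩ := ToPartrec.Code.exists_code h
  refine ⟨c, fun n => ?_⟩
  have := hc (n ::ᵥ List.Vector.nil)
  rw [List.Vector.head_cons] at this
  exact this.trans (Part.map_some _ _)

theorem leads_result {y w p rest : List Bool}
    (hc : c.eval [strNat y] = pure [strNat w]) (hp : p = header y ++ false :: rest) :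
    ∃ b w', w ++ [true] = b :: w' ∧
    Leads c copy (fun n => p.getD n false) .flag 0 (K'.elim [.bit1, .cons] [] [] []) []
      (.output (some b)) ((header y).length + 1) (K'.elim (w'.map bitSym ++ [.cons]) [] [] [])
      [] := by
  obtain ⟨b, w', hw⟩ : ∃ b w', w ++ [true] = b :: w' := List.exists_cons_of_ne_nil (by simp)
  refine ⟨b, w', hw, (leads_header y fun i hi => ?_).trans ((leads_idle
    (s' := .exec (toCodeStmt c (stackProg (trNormal c Cont'.halt))) none) true
    fun r hr => ?_).trans (.trans (o' := []) (s' := .output none)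
      (S' := K'.elim (trList [strNat w]) [] [] []) (pos' := (header y).length + 1) ?_ ?_))⟩
  · rw [hp, List.getD_append _ _ _ _ hi]
  · rw [hp, List.getD_append_right _ _ _ _ le_rfl]
    simp [codeδ]
  · have := leads_code (copy := copy) (ω := fun n => p.getD n false) hc ((header y).length + 1) []
    rwa [trList, trNat_strNat, List.append_assoc] at this
  · have := leads_output_pop (c := c) (copy := copy) (ω := fun n => p.getD n false) _ b w' none
      ((header y).length + 1) [] rfl
    have e : trList [strNat w] = (b :: w').map bitSym ++ [.cons] := by
      simp [← hw, trList, trNat_strNat, bitSym]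
    rw [e]
    simpa using this

theorem codeMachine_computes {y w : List Bool} (hc : c.eval [strNat y] = pure [strNat w]) :
    (codeMachine c false).Computes (header y ++ [false, false]) w := by
  obtain ⟨b, w', hw, h⟩ := leads_result (copy := false) hc
    (p := header y ++ [false, false]) (rest := [false]) rfl
  obtain ⟨q, hq⟩ := leads_output_digits (c := c)
    (ω := fun n => (header y ++ [false, false]).getD n false) w' b ((header y).length + 1) []
  rw [← hw, List.dropLast_concat] at hq
  exact computes_of_leads (h.trans hq) rfl (by simp)

theorem codeMachine_copy_computes {y w z : List Bool}
    (hc : c.eval [strNat y] = pure [strNat w]) (hz : z.length = w.length) :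
    (codeMachine c true).Computes (header y ++ false :: (z ++ [false])) z := by
  obtain ⟨b, w', hw, h⟩ := leads_result (copy := true) hc
    (p := header y ++ false :: (z ++ [false])) rfl
  have hl : z.length = w'.length := by
    have := congrArg List.length hw
    simp only [List.length_append, List.length_cons, List.length_nil] at this
    omega
  obtain ⟨q, hq⟩ := leads_output_copy (c := c)
    (ω := fun n => (header y ++ false :: (z ++ [false])).getD n false) w' z b
    ((header y).length + 1) [] hl fun i hi => by
      rw [List.getD_append_right _ _ _ _ (by omega),
        show (header y).length + 1 + i - (header y).length = i + 1 by omega,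
        List.getD_cons_succ, List.getD_append _ _ _ _ hi]
  exact computes_of_leads (h.trans hq) rfl (by simp; omega)

/-- A computable function is computed by a prefix machine from self-delimiting input. -/
theorem exists_prefixTM_of_computable {F : ℕ → ℕ} (hF : Computable F) :
    ∃ T : PrefixTM, ∀ y w, F (strNat y) = strNat w → T.Computes (header y ++ [false, false]) w := by
  obtain ⟨c, hc⟩ := exists_code_of_computable hF
  exact ⟨codeMachine c false, fun y w h => codeMachine_computes (by rw [hc, h])⟩

/-- A prefix machine that prints a string that follows a self-delimiting description of its
length. -/
theorem exists_prefixTM_print :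
    ∃ T : PrefixTM, ∀ y z, z.length = strNat y →
      T.Computes (header y ++ false :: (z ++ [false])) z := by
  -- `2 ^ n` has exactly `n` digits below its leading one, so the copying machine copies `n` bits.
  have hF : Computable fun n : ℕ => 2 ^ n := (primrec_nat_pow 2).to_comp
  obtain ⟨c, hc⟩ := exists_code_of_computable hF
  refine ⟨codeMachine c true, fun y z h => codeMachine_copy_computes
    (w := List.replicate z.length false) ?_ (by simp)⟩
  rw [hc, strNat_replicate_false, h]

end PrefixTM

/-! ### Bounded runs of a prefix machine are primitive recursive. -/

/-- A function that is primitive recursive for every value of a parameter from a finite type is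
primitive recursive. -/
theorem Primrec.of_finite_left {α β σ : Type*} [Primcodable α] [Primcodable β] [Primcodable σ]
    [Finite α] {f : α → β → σ} (h : ∀ a, Primrec (f a)) : Primrec₂ f := by
  let e := Finite.equivFin α
  have h₁ : Primrec₂ fun (i : Fin (Nat.card α)) b => f (e.symm i) b :=
    Primrec.fin_curry₁.2 fun i => h _
  exact (h₁.comp ((Primrec.dom_finite e).comp Primrec.fst) Primrec.snd).of_eq fun x => by simp

theorem Primrec.pi_fin {α σ : Type*} [Primcodable α] [Primcodable σ] {n : ℕ} {f : α → Fin n → σ}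
    (h : ∀ i, Primrec fun a => f a i) : Primrec f :=
  Primrec.fin_curry.2
    (Primrec₂.swap (f := fun i a => f a i) (Primrec.fin_curry₁.2 h))

namespace PrefixTM

/-- A coding of a finite type. -/
@[reducible] noncomputable def primcodableOfFinite (α : Type) [Finite α] : Primcodable α :=
  Primcodable.ofEquiv _ (Finite.equivFin α)

noncomputable instance (M : PrefixTM) : Primcodable M.Q :=
  have := M.finQ
  primcodableOfFinite M.Q

noncomputable instance (M : PrefixTM) : Primcodable M.Γ :=
  have := M.finΓ
  primcodableOfFinite M.Γ

/-- A work tape as a pair of lists. -/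
def workTapeEquiv (Γ : Type) : WorkTape Γ ≃ List Γ × List Γ where
  toFun T := (T.left, T.right)
  invFun x := ⟨x.1, x.2⟩
  left_inv _ := rfl
  right_inv _ := rfl

/-- A configuration as a tuple. -/
def cfgEquiv (M : PrefixTM) : M.Cfg ≃ M.Q × ℕ × (Fin M.tapes → WorkTape M.Γ) × List Bool where
  toFun c := (c.state, c.pos, c.work, c.out)
  invFun x := ⟨x.1, x.2.1, x.2.2.1, x.2.2.2⟩
  left_inv _ := rfl
  right_inv _ := rfl

instance (Γ : Type) [Primcodable Γ] : Primcodable (WorkTape Γ) :=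
  Primcodable.ofEquiv _ (workTapeEquiv Γ)

noncomputable instance (M : PrefixTM) : Primcodable M.Cfg := Primcodable.ofEquiv _ (cfgEquiv M)

section Tape

variable {Γ : Type} [Primcodable Γ]

theorem primrec_left : Primrec (WorkTape.left : WorkTape Γ → List Γ) :=
  Primrec.fst.comp (Primrec.of_equiv (e := workTapeEquiv Γ))

theorem primrec_right : Primrec (WorkTape.right : WorkTape Γ → List Γ) :=
  Primrec.snd.comp (Primrec.of_equiv (e := workTapeEquiv Γ))

theorem primrec_workTape_mk {α : Type*} [Primcodable α] {f g : α → List Γ} (hf : Primrec f)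
    (hg : Primrec g) : Primrec fun a => (⟨f a, g a⟩ : WorkTape Γ) :=
  (Primrec.of_equiv_symm (e := workTapeEquiv Γ)).comp (hf.pair hg)

theorem primrec_read (b : Γ) : Primrec (WorkTape.read b) :=
  ((Primrec.option_getD.comp (Primrec.list_head?.comp primrec_right) (Primrec.const b))).of_eq
    fun T => by simp [WorkTape.read]

theorem primrec_write (a : Γ) : Primrec (WorkTape.write a) :=
  primrec_workTape_mk primrec_left
    (Primrec.list_cons.comp (Primrec.const a) (Primrec.list_tail.comp primrec_right))

theorem primrec_move (b : Γ) (m : TapeMove) : Primrec (WorkTape.move b m) := by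
  cases m with
  | stay => exact Primrec.id
  | right =>
    exact primrec_workTape_mk (Primrec.list_cons.comp (primrec_read b) primrec_left)
      (Primrec.list_tail.comp primrec_right)
  | left =>
    refine (Primrec.list_casesOn primrec_left Primrec.id
      (primrec_workTape_mk (Primrec.snd.comp Primrec.snd)
        (Primrec.list_cons.comp (Primrec.fst.comp Primrec.snd)
          (primrec_right.comp Primrec.fst))).to₂).of_eq ?_
    rintro ⟨_ | ⟨a, l⟩, r⟩ <;> rfl

end Tape

section Cfg

variable {M : PrefixTM}

theorem primrec_state : Primrec (Cfg.state : M.Cfg → M.Q) :=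
  Primrec.fst.comp (Primrec.of_equiv (e := cfgEquiv M))

theorem primrec_pos : Primrec (Cfg.pos : M.Cfg → ℕ) :=
  Primrec.fst.comp (Primrec.snd.comp (Primrec.of_equiv (e := cfgEquiv M)))

theorem primrec_work (j : Fin M.tapes) : Primrec fun c : M.Cfg => c.work j :=
  (Primrec.fin_app.comp (Primrec.fst.comp (Primrec.snd.comp (Primrec.snd.comp
    (Primrec.of_equiv (e := cfgEquiv M))))) (Primrec.const j) :)

theorem primrec_out : Primrec (Cfg.out : M.Cfg → List Bool) :=
  Primrec.snd.comp (Primrec.snd.comp (Primrec.snd.comp (Primrec.of_equiv (e := cfgEquiv M))))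

theorem primrec_act (a : PrefixAction M.Q M.Γ M.tapes) : Primrec fun c : M.Cfg => c.act a := by
  have hpos : Primrec fun c : M.Cfg => if a.advance then c.pos + 1 else c.pos := by
    cases a.advance
    · simpa using primrec_pos
    · simpa using Primrec.succ.comp primrec_pos
  exact (Primrec.of_equiv_symm (e := cfgEquiv M)).comp ((Primrec.const a.state).pair
    (hpos.pair ((Primrec.pi_fin (fun j =>
      (primrec_move M.blank (a.work j).2).comp
        ((primrec_write (a.work j).1).comp (primrec_work j)))).pair
      (Primrec.list_append.comp primrec_out (Primrec.const a.out.toList)))))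

/-- The transition function is a finite table: once state, input bit and scanned symbols are fixed,
the step is a fixed action or a halt. -/
theorem primrec_step (M : PrefixTM) :
    Primrec₂ fun (p : List Bool) (c : M.Cfg) => M.step (fun n => p.getD n false) c := by
  have := M.finQ
  have := M.finΓ
  have h : Primrec₂ fun (d : M.Q × Bool × (Fin M.tapes → M.Γ)) (c : M.Cfg) =>
      (M.δ d.1 d.2.1 d.2.2).map c.act := by
    refine Primrec.of_finite_left fun d => ?_
    cases M.δ d.1 d.2.1 d.2.2 with
    | none => exact Primrec.const none
    | some a => exact Primrec.option_some.comp (primrec_act a)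
  exact h.comp (((primrec_state).comp Primrec.snd).pair
    (((Primrec.list_getD false).comp Primrec.fst (primrec_pos.comp Primrec.snd)).pair
      (Primrec.pi_fin (fun j =>
        (primrec_read M.blank).comp ((primrec_work j).comp Primrec.snd))))) Primrec.snd

theorem primrec_run (M : PrefixTM) :
    Primrec₂ fun (p : List Bool) (t : ℕ) => M.run (fun n => p.getD n false) t := by
  refine (Primrec.nat_rec (f := fun _ : List Bool => some M.init)
    (g := fun p x => x.2.bind (M.step fun n => p.getD n false)) (Primrec.const _)
    (Primrec.option_bind (Primrec.snd.comp Primrec.snd)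
      ((primrec_step M).comp (Primrec.fst.comp Primrec.fst) Primrec.snd).to₂)).of_eq fun p t => ?_
  induction t with
  | zero => rfl
  | succ t ih => simp only at ih ⊢; rw [ih]; rfl

open scoped Classical in
/-- The output of a program that halts after exactly `t` steps. -/
noncomputable def output (M : PrefixTM) (p : List Bool) (t : ℕ) : Option (List Bool) :=
  (M.run (fun n => p.getD n false) t).bind fun c =>
    if M.step (fun n => p.getD n false) c = none ∧ c.pos + 1 = p.length then some c.out else none

theorem output_eq_some {p y : List Bool} {t : ℕ} : M.output p t = some y ↔ M.Runs p y t := by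
  simp only [output, Option.bind_eq_some_iff, Runs]
  refine exists_congr fun c => and_congr_right fun _ => ?_
  split_ifs with h <;> simp_all

theorem primrec_output (M : PrefixTM) : Primrec₂ M.output := by
  classical
  refine (Primrec.option_bind (primrec_run M) ?_)
  refine Primrec.ite (PrimrecPred.and ?_ ?_) (Primrec.option_some.comp
    (primrec_out.comp Primrec.snd)) (Primrec.const none)
  · exact Primrec.eq.comp ((primrec_step M).comp (Primrec.fst.comp Primrec.fst) Primrec.snd)
      (Primrec.const none)
  · exact Primrec.eq.comp (Primrec.succ.comp (primrec_pos.comp Primrec.snd))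
      (Primrec.list_length.comp (Primrec.fst.comp Primrec.fst))

end Cfg

/-! ### Enumerating the outputs of short, fast programs. -/

/-- All strings of length `n`. -/
def strings : ℕ → List (List Bool)
  | 0 => [[]]
  | n + 1 => (strings n).flatMap fun x => [false :: x, true :: x]

theorem mem_strings {n : ℕ} {x : List Bool} : x ∈ strings n ↔ x.length = n := by
  induction n generalizing x with
  | zero => simp [strings]
  | succ n ih =>
    cases x with
    | nil => simp [strings]
    | cons b x => cases b <;> simp [strings, ih]

theorem primrec_strings : Primrec strings :=
  (Primrec.nat_rec₁ (f := fun _ (l : List (List Bool)) =>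
    l.flatMap fun x => [false :: x, true :: x]) [[]]
    (Primrec.list_flatMap Primrec.snd (Primrec.list_cons.comp
      (Primrec.list_cons.comp (Primrec.const false) Primrec.snd)
      (Primrec.list_cons.comp (Primrec.list_cons.comp (Primrec.const true) Primrec.snd)
        (Primrec.const []))).to₂)).of_eq fun n => by
    induction n with
    | zero => rfl
    | succ n ih => simp only at ih ⊢; rw [ih]; rfl

/-- The outputs of the programs of length less than `n` that halt in at most `s` steps. -/
noncomputable def outputs (M : PrefixTM) (n s : ℕ) : List (List Bool) :=
  (List.range n).flatMap fun k => (strings k).flatMap fun p =>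
    (List.range (s + 1)).flatMap fun t => (M.output p t).toList

theorem mem_outputs {M : PrefixTM} {n s : ℕ} {x : List Bool} :
    x ∈ M.outputs n s ↔ ∃ p, p.length < n ∧ ∃ t ≤ s, M.Runs p x t := by
  simp [outputs, mem_strings, output_eq_some]

theorem primrec_option_toList {α : Type*} [Primcodable α] :
    Primrec (Option.toList : Option α → List α) :=
  (Primrec.option_casesOn Primrec.id (Primrec.const [])
    (Primrec.list_cons.comp Primrec.snd (Primrec.const [])).to₂).of_eq fun o => by cases o <;> rfl

theorem primrec_outputs (M : PrefixTM) : Primrec₂ M.outputs := by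
  refine Primrec.list_flatMap (Primrec.list_range.comp Primrec.fst) ?_
  refine Primrec.list_flatMap (primrec_strings.comp Primrec.snd) ?_
  refine Primrec.list_flatMap (Primrec.list_range.comp (Primrec.succ.comp
    (Primrec.snd.comp (Primrec.fst.comp Primrec.fst)))) ?_
  exact primrec_option_toList.comp ((primrec_output M).comp (Primrec.snd.comp Primrec.fst)
    Primrec.snd)

end PrefixTM

/-! ### Logarithms and unbounded search. -/

theorem Nat.two_mul_add_lt_two_pow {a l : ℕ} (h : a + 4 ≤ l) : 2 * l + a < 2 ^ l := by
  induction l, h using Nat.le_induction with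
  | base =>
    have := Nat.lt_two_pow_self (n := a)
    rw [pow_add]
    omega
  | succ l _ ih =>
    rw [pow_succ]
    omega

theorem eventually_two_mul_log_add_lt (a : ℕ) :
    ∀ᶠ n in Filter.atTop, 2 * Nat.log 2 n + a < n := by
  filter_upwards [Filter.eventually_ge_atTop (2 ^ (a + 4))] with n hn
  have h₀ : n ≠ 0 := by have := Nat.two_pow_pos (a + 4); omega
  exact (Nat.two_mul_add_lt_two_pow (Nat.le_log_of_pow_le one_lt_two hn)).trans_le
    (Nat.pow_log_le_self 2 h₀)

theorem primrec_log_two : Primrec (Nat.log 2) := by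
  refine (Primrec.nat_findGreatest (f := id) (p := fun n k => 2 ^ k ≤ n) Primrec.id
    (Primrec.nat_le.comp ((primrec_nat_pow 2).comp Primrec.snd) Primrec.fst)).of_eq fun n => ?_
  rcases Nat.eq_zero_or_pos n with rfl | hn
  · simp
  · refine Nat.findGreatest_eq_iff.2 ⟨Nat.log_le_self 2 n, fun _ => Nat.pow_log_le_self 2 hn.ne',
      fun k hk _ h => ?_⟩
    exact absurd (Nat.le_log_of_pow_le one_lt_two h) (by omega)

/-- Unbounded search for a witness of a primitive recursive relation. -/
theorem PrimrecRel.exists_computable {R : ℕ → ℕ → Prop} (hR : PrimrecRel R)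
    (h : ∀ n, ∃ s, R n s) : ∃ D : ℕ → ℕ, Computable D ∧ ∀ n, R n (D n) := by
  classical
  have hp : Partrec fun n => Nat.rfind fun s => (Part.some (decide (R n s)) : Part Bool) :=
    Partrec.rfind (p := fun n s => (Part.some (decide (R n s)) : Part Bool))
      hR.decide.to_comp.partrec
  have hd : ∀ n, (Nat.rfind fun s => (Part.some (decide (R n s)) : Part Bool)).Dom := fun n => by
    obtain ⟨s, hs⟩ := h n
    exact Nat.rfind_dom.2 ⟨s, by simpa using hs, fun _ => trivial⟩
  refine ⟨fun n => (Nat.rfind fun s => (Part.some (decide (R n s)) : Part Bool)).get (hd n),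
    hp.of_eq fun n => (Part.some_get _).symm, fun n => ?_⟩
  simpa using Nat.rfind_spec (Part.get_mem (hd n))

/-! ### Strings without short, fast programs. -/

namespace PrefixTM

variable {U : PrefixTM}

theorem primrec_strNat : Primrec strNat := by
  refine (Primrec.list_foldr (f := id) (g := fun _ => 1) (h := fun (_ : List Bool) x =>
    2 * x.2 + bif x.1 then 1 else 0) Primrec.id (Primrec.const 1)
    (Primrec.nat_add.comp (Primrec.nat_mul.comp (Primrec.const 2) (Primrec.snd.comp Primrec.snd))
      (Primrec.cond (Primrec.fst.comp Primrec.snd) (Primrec.const 1)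
        (Primrec.const 0))).to₂).of_eq fun y => ?_
  induction y with
  | nil => rfl
  | cons b y ih => cases b <;> simp_all [strNat, Nat.bit_val]

theorem Runs.output_unique {p y z : List Bool} {s t : ℕ} (h : U.Runs p y s) (h' : U.Runs p z t) :
    y = z := by
  obtain rfl := h.time_unique h'
  exact Option.some_injective _ ((output_eq_some.2 h).symm.trans (output_eq_some.2 h'))

/-- Counting: a program has at most one output, and there are only `2 ^ n - 1` programs shorter than
`n`. -/
theorem exists_notMem_outputs (U : PrefixTM) (n s : ℕ) :
    ∃ x : List Bool, x.length = n ∧ x ∉ U.outputs n s := by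
  by_contra! h
  have h' : ∀ x : List.Vector Bool n, ∃ p : Σ k : Fin n, List.Vector Bool k,
      ∃ t, U.Runs p.2.1 x.1 t := fun x => by
    obtain ⟨p, hp, t, -, ht⟩ := mem_outputs.1 (h x.1 x.2)
    exact ⟨⟨⟨p.length, hp⟩, ⟨p, rfl⟩⟩, t, ht⟩
  choose f hf using h'
  have hinj : Function.Injective f := fun x y hxy => by
    obtain ⟨s, hs⟩ := hf x
    obtain ⟨t, ht⟩ := hf y
    rw [← hxy] at ht
    exact Subtype.ext (hs.output_unique ht)
  have := Fintype.card_le_of_injective f hinj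
  rw [card_vector, Fintype.card_sigma] at this
  simp only [card_vector, Fintype.card_bool] at this
  rw [Fin.sum_univ_eq_sum_range (fun k => 2 ^ k) n, Nat.geomSum_eq le_rfl] at this
  have := Nat.two_pow_pos n
  omega

theorem primrecRel_mem {α : Type*} [Primcodable α] :
    PrimrecRel fun (x : α) (l : List α) => x ∈ l :=
  ((PrimrecRel.exists_mem_list (Primrec.eq (α := α))).comp Primrec.snd Primrec.fst).of_eq
    fun x => by simp

open scoped Classical in
/-- The first string of length `n` that no program of length less than `n` outputs in at most `s`
steps. -/
noncomputable def firstMissing (U : PrefixTM) (b : ℕ × ℕ) : List Bool :=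
  ((strings b.1).filter fun x => x ∉ U.outputs b.1 b.2).head?.getD []

theorem primrec_firstMissing (U : PrefixTM) : Primrec U.firstMissing := by
  classical
  have hR : PrimrecRel fun (x : List Bool) (b : ℕ × ℕ) => x ∉ U.outputs b.1 b.2 :=
    PrimrecPred.not (primrecRel_mem.comp Primrec.fst ((primrec_outputs U).comp
      (Primrec.fst.comp Primrec.snd) (Primrec.snd.comp Primrec.snd)))
  exact Primrec.option_getD.comp (Primrec.list_head?.comp
    (hR.listFilter.comp (primrec_strings.comp Primrec.fst) Primrec.id)) (Primrec.const [])

theorem firstMissing_spec (U : PrefixTM) (n s : ℕ) :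
    (U.firstMissing (n, s)).length = n ∧ U.firstMissing (n, s) ∉ U.outputs n s := by
  classical
  obtain ⟨x, hx, hx'⟩ := exists_notMem_outputs U n s
  have hmem : U.firstMissing (n, s) ∈ (strings n).filter fun x => x ∉ U.outputs n s := by
    rw [firstMissing]
    cases h : (strings n).filter fun x => x ∉ U.outputs n s with
    | nil =>
      rw [List.filter_eq_nil_iff] at h
      exact absurd (decide_eq_true hx') (h x (mem_strings.2 hx))
    | cons a l => simp
  rw [List.mem_filter, mem_strings, decide_eq_true_iff] at hmem
  exact hmem

/-! ### Complexity, depth and gaps. -/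

theorem K_le {p x : List Bool} (h : U.Computes p x) : U.K x ≤ p.length := Nat.sInf_le ⟨p, rfl, h⟩

theorem exists_length_eq_K {x : List Bool} (h : ∃ p, U.Computes p x) :
    ∃ p, p.length = U.K x ∧ U.Computes p x := by
  obtain ⟨p, hp⟩ := h
  exact Nat.sInf_mem (s := {n | ∃ p : List Bool, p.length = n ∧ U.Computes p x}) ⟨_, p, rfl, hp⟩

theorem depth_le {p x : List Bool} {b t : ℕ} (hp : p.length ≤ U.K x + b) (h : U.Runs p x t) :
    U.depth b x ≤ t := Nat.sInf_le ⟨p, hp, h⟩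

theorem exists_runs_depth {x : List Bool} (h : ∃ p, U.Computes p x) (b : ℕ) :
    ∃ p, p.length ≤ U.K x + b ∧ U.Runs p x (U.depth b x) := by
  obtain ⟨p, hp, t, ht⟩ := exists_length_eq_K h
  exact Nat.sInf_mem (s := {t | ∃ p : List Bool, p.length ≤ U.K x + b ∧ U.Runs p x t})
    ⟨t, p, by omega, ht⟩

theorem isLeast_depth_zero {x : List Bool} (h : ∃ p, U.Computes p x) :
    IsLeast {t | ∃ p, IsLeast {n | ∃ q, q.length = n ∧ U.Computes q x} p.length ∧
      U.Runs p x t} (U.depth 0 x) := by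
  obtain ⟨p, hp, hr⟩ := exists_runs_depth h 0
  refine ⟨⟨p, ⟨⟨p, rfl, _, hr⟩, ?_⟩, hr⟩, ?_⟩
  · rintro _ ⟨q, rfl, hq⟩
    exact hp.trans (K_le hq)
  · rintro t ⟨q, hq, ht⟩
    obtain ⟨r, hr, hr'⟩ := exists_length_eq_K h
    exact depth_le (hr ▸ hq.2 ⟨r, rfl, hr'⟩) ht

theorem depth_le_depth_zero {x : List Bool} (h : ∃ p, U.Computes p x) (b : ℕ) :
    U.depth b x ≤ U.depth 0 x := by
  obtain ⟨p, hp, hr⟩ := exists_runs_depth h 0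
  exact depth_le (by omega) hr

theorem gap_le_depth (x : List Bool) (b : ℕ) : U.gap x b ≤ U.depth b x := Nat.sub_le _ _

theorem exists_forall_gap_le {x : List Bool} (h : ∃ p, U.Computes p x) :
    ∃ i, ∀ b, U.gap x b ≤ U.gap x i := by
  have hb : BddAbove (Set.range (U.gap x)) := ⟨U.depth 0 x, by
    rintro _ ⟨b, rfl⟩
    exact (gap_le_depth x b).trans (depth_le_depth_zero h b)⟩
  obtain ⟨i, hi⟩ := Nat.sSup_mem (Set.range_nonempty _) hb
  exact ⟨i, fun b => hi ▸ le_csSup hb ⟨b, rfl⟩⟩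

/-- Telescoping over the first `B` gaps. -/
theorem depth_zero_le_depth_add {x : List Bool} {h : ℕ} (hgap : ∀ b, U.gap x b ≤ h) (B : ℕ) :
    U.depth 0 x ≤ U.depth B x + B * h := by
  induction B with
  | zero => simp
  | succ B ih =>
    have := hgap B
    rw [gap] at this
    rw [add_mul]
    omega

theorem depth_zero_le_BB {x : List Bool} {n : ℕ} (h : ∃ p, U.Computes p x ∧ p.length ≤ n) :
    U.depth 0 x ≤ U.BB n := by
  obtain ⟨q, hq, hn⟩ := h
  obtain ⟨p, hp, hr⟩ := exists_runs_depth ⟨q, hq⟩ 0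
  exact le_csSup (haltingTimes_finite U n).bddAbove
    ⟨p, x, hp.trans ((K_le hq).trans hn), hr⟩

/-! ### Short programs, deep strings and large gaps. -/

theorem IsReferenceOptimal.exists_length_lt (hU : U.IsReferenceOptimal) :
    ∃ c, ∀ x : List Bool, 2 ≤ x.length →
      ∃ p, U.Computes p x ∧ p.length < x.length + c * Nat.log 2 x.length := by
  obtain ⟨T, hT⟩ := exists_prefixTM_print
  obtain ⟨i, hi, -⟩ := hU.2 T
  -- The program has length `|i| + 2 log |x| + 2 + |x|`. Since `log |x| ≥ 1`, the additive constants
  -- are absorbed into the factor of the logarithm, with room for strictness.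
  refine ⟨i.length + 5, fun x hx => ?_⟩
  obtain ⟨y, hy, hl⟩ := exists_strNat_eq (n := x.length) (by omega)
  refine ⟨_, (hi _ _).2 (hT y x hy.symm), ?_⟩
  have : 1 ≤ Nat.log 2 x.length := Nat.log_pos one_lt_two hx
  simp only [List.length_append, length_header, hl, List.length_cons, List.length_nil]
  nlinarith

/-- There are finitely many strings of each length, so a common time bound exists; as the condition
on it is primitive recursive, it is found by search. -/
theorem exists_computable_forall_mem_outputs {c : ℕ} (hc : ∀ x : List Bool, 2 ≤ x.length →
      ∃ p, U.Computes p x ∧ p.length < x.length + c * Nat.log 2 x.length) :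
    ∃ D : ℕ → ℕ, Computable D ∧ ∀ x : List Bool, 2 ≤ x.length →
      x ∈ U.outputs (x.length + c * Nat.log 2 x.length) (D x.length) := by
  have hR : PrimrecRel fun n s : ℕ =>
      -- The first alternative makes the search terminate for `n < 2`, where `hc` says nothing.
      n < 2 ∨ ∀ x ∈ strings n, x ∈ U.outputs (n + c * Nat.log 2 n) s := by
    refine PrimrecPred.or (Primrec.nat_lt.comp Primrec.fst (Primrec.const 2)) ?_
    exact (PrimrecRel.forall_mem_list primrecRel_mem).comp (primrec_strings.comp Primrec.fst)
      ((primrec_outputs U).comp (Primrec.nat_add.comp Primrec.fst (Primrec.nat_mul.comp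
        (Primrec.const c) (primrec_log_two.comp Primrec.fst))) Primrec.snd)
  obtain ⟨D, hD, hD'⟩ := hR.exists_computable fun n => by
    rcases Nat.lt_or_ge n 2 with hn | hn
    · exact ⟨0, .inl hn⟩
    · have : ∀ x : List Bool, ∃ t, x.length = n →
          x ∈ U.outputs (n + c * Nat.log 2 n) t := fun x => by
        by_cases hx : x.length = n
        · obtain ⟨p, ⟨t, ht⟩, hp⟩ := hc x (hx ▸ hn)
          exact ⟨t, fun _ => mem_outputs.2 ⟨p, hx ▸ hp, t, le_rfl, ht⟩⟩
        · exact ⟨0, fun h => absurd h hx⟩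
      choose t ht using this
      refine ⟨(strings n).toFinset.sup t, .inr fun x hx => ?_⟩
      obtain ⟨p, hp, s, hs, h⟩ := mem_outputs.1 (ht x (mem_strings.1 hx))
      exact mem_outputs.2 ⟨p, hp, s, hs.trans (Finset.le_sup (f := t) (by simpa using hx)), h⟩
  refine ⟨D, hD, fun x hx => ?_⟩
  exact (hD' x.length).resolve_left (by omega) x (mem_strings.2 rfl)

/-- For every computable `f` and every large `n` there is a string of length `n` none of whose
shortest programs halts within `f n` steps. -/
theorem IsReferenceOptimal.eventually_exists_lt_depth (hU : U.IsReferenceOptimal) {f : ℕ → ℕ}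
    (hf : Computable f) :
    ∀ᶠ n in Filter.atTop, ∃ x : List Bool, x.length = n ∧ f n < U.depth 0 x := by
  have hg : Computable fun n => strNat (U.firstMissing (n, f n)) :=
    (primrec_strNat.comp (primrec_firstMissing U)).to_comp.comp (Computable.id.pair hf)
  obtain ⟨T, hT⟩ := exists_prefixTM_of_computable hg
  obtain ⟨i, hi, -⟩ := hU.2 T
  -- For such `n` the missing string has complexity at most `|i| + 2 log n + 2 < n`, so its shortest
  -- programs are among those that failed to output it in time.
  filter_upwards [eventually_two_mul_log_add_lt (i.length + 2), Filter.eventually_ne_atTop 0]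
    with n hn hn'
  refine ⟨U.firstMissing (n, f n), (firstMissing_spec U n (f n)).1, ?_⟩
  obtain ⟨y, hy, hl⟩ := exists_strNat_eq hn'
  have hcomp := (hi _ _).2 (hT y (U.firstMissing (n, f n)) (by rw [hy]))
  have hK := K_le hcomp
  simp only [List.length_append, length_header, hl, List.length_cons, List.length_nil] at hK
  obtain ⟨p, hp, hr⟩ := exists_runs_depth ⟨_, hcomp⟩ 0
  by_contra! h
  exact (firstMissing_spec U n (f n)).2 (mem_outputs.2 ⟨p, by omega, _, h, hr⟩)

theorem depth_le_of_mem_outputs {x : List Bool} {n s b : ℕ} (h : x ∈ U.outputs n s)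
    (hn : n ≤ U.K x + b) : U.depth b x ≤ s := by
  obtain ⟨p, hp, t, ht, hr⟩ := mem_outputs.1 h
  exact (depth_le (by omega) hr).trans ht

theorem exists_deepest (U : PrefixTM) (n : ℕ) :
    ∃ x : List Bool, x.length = n ∧ ∀ y : List Bool, y.length = n → U.depth 0 y ≤ U.depth 0 x := by
  obtain ⟨x, hx, h⟩ := (List.finite_length_eq Bool n).exists_maximalFor (U.depth 0) _
    ⟨List.replicate n false, by simp⟩
  exact ⟨x, hx, fun y hy => (le_total _ _).elim id fun h' => h hy h'⟩

/-- The largest gap of a deepest string of length `n` outgrows every computable function. -/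
theorem IsReferenceOptimal.eventually_lt_gap (hU : U.IsReferenceOptimal) {c : ℕ} {D : ℕ → ℕ}
    (hD : Computable D) (hD' : ∀ x : List Bool, 2 ≤ x.length →
      x ∈ U.outputs (x.length + c * Nat.log 2 x.length) (D x.length))
    {f : ℕ → ℕ} (hf : Computable f) :
    ∀ᶠ n in Filter.atTop, ∀ x : List Bool, x.length = n →
      (∀ y : List Bool, y.length = n → U.depth 0 y ≤ U.depth 0 x) →
      ∀ i, (∀ b, U.gap x b ≤ U.gap x i) → f n < U.gap x i := by
  have hN : Computable fun n => n + c * Nat.log 2 n :=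
    (Primrec.nat_add.comp Primrec.id
      (Primrec.nat_mul.comp (Primrec.const c) primrec_log_two)).to_comp
  -- The total drop from significance `0` to `n + c log n` must exceed that many times `f n`, after
  -- the remaining depth, at most `D n`, is subtracted.
  have hf' : Computable fun n => D n + (n + c * Nat.log 2 n) * f n :=
    Primrec.nat_add.to_comp.comp hD (Primrec.nat_mul.to_comp.comp hN hf)
  filter_upwards [hU.eventually_exists_lt_depth hf', Filter.eventually_ge_atTop 2]
    with n ⟨y, hy, hlt⟩ hn x hx hmax i hi
  subst hx
  have h₁ := depth_zero_le_depth_add hi (x.length + c * Nat.log 2 x.length)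
  have h₂ := depth_le_of_mem_outputs (b := x.length + c * Nat.log 2 x.length) (hD' x hn)
    (Nat.le_add_left _ _)
  have h₃ := hmax y hy
  exact Nat.lt_of_mul_lt_mul_left (a := x.length + c * Nat.log 2 x.length) (by omega)

end PrefixTM

/-! ### The sequence of deepest strings. -/

theorem theorem3 (U : PrefixTM) (hU : U.IsReferenceOptimal) :
    ∃ (x : ℕ → List Bool) (h : ℕ → ℕ) (i : ℕ → ℕ) (c : ℕ),
      -- consecutive lengths
      (∀ m, (x (m + 1)).length = (x m).length + 1) ∧
      -- `h m` is the maximal gap between depths of `x m` at consecutive significances,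
      -- and it is attained at a significance `i m < |x m| - K (x m) + O(log |x m|)`
      (∀ m, h m = U.gap (x m) (i m)) ∧
      (∀ m b, U.gap (x m) b ≤ h m) ∧
      (∀ m, i m + U.K (x m) < (x m).length + c * Nat.log 2 (x m).length) ∧
      -- the depth at significance `0` is the least running time of a shortest program
      (∀ m, IsLeast {t | ∃ p, IsLeast {n | ∃ q, q.length = n ∧ U.Computes q (x m)} p.length ∧
        U.Runs p (x m) t} (U.depth 0 (x m))) ∧
      -- the two bounds on the depth at significance `0`
      (∀ m, h m ≤ U.depth 0 (x m) ∧
        U.depth 0 (x m) ≤ U.BB ((x m).length + c * Nat.log 2 (x m).length)) ∧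
      -- `h`, hence also the depth at significance `0`, outgrows every computable function
      (∀ f : ℕ → ℕ, Computable f →
        ∀ᶠ m in Filter.atTop, f m < h m ∧ f m < U.depth 0 (x m)) := by
  obtain ⟨c, hc⟩ := hU.exists_length_lt
  obtain ⟨D, hD, hD'⟩ := PrefixTM.exists_computable_forall_mem_outputs hc
  -- The sequence starts at a length `N` from which on the largest gap exceeds the time bound `D`
  -- itself.
  obtain ⟨N, hN⟩ := Filter.eventually_atTop.1 ((hU.eventually_lt_gap hD hD' hD).and
    (Filter.eventually_ge_atTop 2))
  choose X hX hmax using PrefixTM.exists_deepest U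
  have hlen : ∀ m, 2 ≤ (X (N + m)).length := fun m => by
    rw [hX]
    exact (hN (N + m) (by omega)).2
  have hprog : ∀ m, ∃ p, U.Computes p (X (N + m)) := fun m => (hc _ (hlen m)).imp fun _ h => h.1
  choose i hi using fun m => PrefixTM.exists_forall_gap_le (hprog m)
  have hle : ∀ m, U.gap (X (N + m)) (i m) ≤ U.depth 0 (X (N + m)) := fun m =>
    (PrefixTM.gap_le_depth _ _).trans (PrefixTM.depth_le_depth_zero (hprog m) _)
  refine ⟨fun m => X (N + m), fun m => U.gap (X (N + m)) (i m), i, c,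
    fun m => by simp [hX, add_assoc], fun m => rfl, hi, fun m => ?_,
    fun m => PrefixTM.isLeast_depth_zero (hprog m),
    fun m => ⟨hle m, PrefixTM.depth_zero_le_BB ((hc _ (hlen m)).imp fun p h => ⟨h.1, h.2.le⟩)⟩,
    fun f hf => ?_⟩
  -- At a significance this large the depth is at most `D`, whereas the gap there exceeds `D` and is
  -- at most the depth.
  · by_contra! h
    have h₁ := PrefixTM.depth_le_of_mem_outputs (b := i m) (hD' _ (hlen m)) (by omega)
    have h₂ := (hN (N + m) (by omega)).1 _ (hX _) (hmax _) (i m) (hi m)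
    have h₃ := PrefixTM.gap_le_depth (U := U) (X (N + m)) (i m)
    rw [hX] at h₁
    omega
  -- The growth lemma is indexed by length `m + N`, the claim by `m`; hence the shift.
  · have hf' : Computable fun n => f (n - N) :=
      hf.comp (Primrec.nat_sub.comp Primrec.id (Primrec.const N)).to_comp
    filter_upwards [(Filter.tendsto_add_atTop_nat N).eventually
      (hU.eventually_lt_gap hD hD' hf')] with m hm
    have := hm (X (N + m)) (by rw [hX, add_comm])
      (fun y hy => hmax _ y (by rw [hy, add_comm])) _ (hi m)
    rw [Nat.add_sub_cancel] at this
    exact ⟨this, this.trans_le (hle m)⟩
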